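/- Let $D$ be one of $\mathbb Z,\mathbb Q,\mathbb R$ (more generally, a linearly ordered abelian group). Let $\mathcal K$ be a set of constant symbols, each coded by a natural number and denoting an element of $D$ (for $D=\mathbb Z,\mathbb Q$ one may take $\mathcal K=D$ with the usual numerals). *Constraints* over a set of variables are finite nonempty conjunctions of literals $e\odot e'$ with $\odot\in\{=,\neq,<,\le\}$, where expressions $e$ are built from variables and constants by $+$ and $-$. *Formulas* are the first-order formulas over such literals, and $\equiv$ denotes equivalence over $D$. A *DDSA* $\mathcal B=\langle B,b_0,\mathcal A,T,F,V,\alpha_0,guard\rangle$ consists of a finite set $B$ of states with an initial state $b_0$, a finite set $\mathcal A$ of actions, a (possibly partial) transition function $T:B\times\mathcal A\to B$, final states $F\subseteq B$, a finite set $V$ of variables, an initial assignment $\alpha_0$ of constants to $V$, and for every action $a$ a constraint $guard(a)$ over two copies $V^r,V^w$ of $V$. We write $b\xrightarrow{a}b'$ if $T(b,a)=b'$. Put $\Delta_a=guard(a)\wedge\bigwedge\{v^w=v^r : v^w \text{ does not occur in } guard(a)\}$ and $update(\varphi,a)=\exists \vec U.\ \varphi(\vec U)\wedge\Delta_a(\vec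 U,\vec V)$. Let $\mathcal C$ be a finite set of constraints over $V$. A *symbolic run* is a sequence $\sigma: b_0\xrightarrow{a_1}b_1\xrightarrow{a_2}\cdots\xrightarrow{a_n}b_n$; a *constraint sequence* along $\sigma$ is $\mathbf C=\langle C_0,\dots,C_n\rangle$ with all $C_i\subseteq\mathcal C$. The *history constraint* is $h(\sigma,\mathbf C)=\bigwedge_{v}v=\alpha_0(v)\wedge\bigwedge C_0$ if $n=0$, and $h(\sigma,\mathbf C)=update(h(\sigma|_{n-1},\mathbf C|_{n-1}),a_n)\wedge\bigwedge C_n$ otherwise. *Bounded lookback.* For $\sigma$ and $\mathbf C$ as above, the computation graph $G_{\sigma,\mathbf C}$ is the undirected graph on the nodes $v_i$ ($v\in V$, $0\le i\le n$) in which two distinct nodes are adjacent iff they occur in a common literal of some $\Delta_{a_k}(\vec V_{k-1},\vec V_k)$ ($1\le k\le n$) or of some constraint of $C_k(\vec V_k)$ ($0\le k\le n$). Let $[G_{\sigma,\mathbf C}]$ be the graph obtained from it by collapsing all edges that stem from equality literals $x_i=y_j$ between two variables. The pair $(\mathcal B,\mathcal C)$ has *$K$-bounded lookback* if for all symbolic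 runs $\sigma$ and all constraint sequences $\mathbf C$ along $\sigma$, every acyclic path (no repeated node) in $[G_{\sigma,\mathbf C}]$ has length at most $K$. *Finite summary.* A *history set* is a set $\Phi$ of pairs $(b,\varphi)$ with $b\in B$ and $\varphi$ a formula with free variables in $V$, such that for every $h(\sigma,\mathbf C)$ where $\sigma$ ends in $b$ there is $(b,\varphi)\in\Phi$ with $h(\sigma,\mathbf C)\equiv\varphi$, and all pairs in $\Phi$ arise in this way. A *summary* is a pair $(\Phi,\sim)$ of a history set $\Phi$ and an equivalence relation $\sim$ on formulas such that (1) on the formulas of $\Phi$, $\sim$ contains $\equiv$ and is decidable (by an algorithm on Gödel numbers, relative to the given coding of the constants); (2) for all $(b,\varphi),(b,\psi)\in\Phi$ with $\varphi\sim\psi$: (a) $\varphi$ is satisfiable iff $\psi$ is; (b) for all $b\xrightarrow{a}b'$ and $C\subseteq\mathcal C$, if $(b',\varphi'),(b',\psi')\in\Phi$ with $\varphi'\equiv update(\varphi,a)\wedge\bigwedge C$ and $\psi'\equiv update(\psi,a)\wedge\bigwedge C$, then $\varphi'\sim\psi'$. The pair $(\mathcal B,\mathcal C)$ *has finite summary*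 if there is a summary $(\Phi,\sim)$ such that $\sim$ has only finitely many classes on the formulas of $\Phi$. **Theorem.** If $(\mathcal B,\mathcal C)$ has $K$-bounded lookback for some $K\in\mathbb N$, then $(\mathcal B,\mathcal C)$ has finite summary. -/

import Mathlib

open FirstOrder

namespace DDSAFormal

/-! ### Linear arithmetic over a domain `D` with constants named by `K` -/

/-- Function symbols of linear arithmetic: constants (named by elements of `K`), `+` and `-`. -/
inductive LinFun (K : Type*) : ℕ → Type _
  | const (k : K) : LinFun K 0
  | add : LinFun K 2
  | sub : LinFun K 2

/-- Relation symbols of linear arithmetic: `<` and `≤` (equality is built into first-order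
logic, and `≠` is its negation). -/
inductive LinRel : ℕ → Type
  | lt : LinRel 2
  | le : LinRel 2

/-- The first-order language of linear arithmetic. -/
def linLang (K : Type*) : Language := ⟨LinFun K, LinRel⟩

/-- The standard interpretation of linear arithmetic in `D`, where the constant symbol `k`
denotes the element `ι k`. -/
@[reducible] def linStructure {K D : Type*} [AddCommGroup D] [LinearOrder D] (ι : K → D) :
    (linLang K).Structure D where
  funMap := fun {_} f xs =>
    match f, xs with
    | LinFun.const k, _ => ι k
    | LinFun.add, xs => xs 0 + xs 1
    | LinFun.sub, xs => xs 0 - xs 1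
  RelMap := fun {_} r xs =>
    match r, xs with
    | LinRel.lt, xs => xs 0 < xs 1
    | LinRel.le, xs => xs 0 ≤ xs 1

/-- Arithmetic expressions over variables `X`: `e ::= x | k | e + e | e - e`. -/
abbrev Expr (K X : Type*) := (linLang K).Term X

/-- First-order formulas of linear arithmetic with free variables in `X`. -/
abbrev Fml (K X : Type*) := (linLang K).Formula X

/-- `α ⊨ φ`: the formula `φ` is true in `D` under the assignment `α`. -/
def Sat {K D X : Type*} [AddCommGroup D] [LinearOrder D] (ι : K → D) (α : X → D)
    (φ : Fml K X) : Prop :=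
  letI := linStructure ι
  φ.Realize α

/-- `φ ≡ ψ`: logical equivalence over the domain `D`. -/
def Equivalent {K D X : Type*} [AddCommGroup D] [LinearOrder D] (ι : K → D)
    (φ ψ : Fml K X) : Prop :=
  ∀ α : X → D, Sat ι α φ ↔ Sat ι α ψ

/-- Satisfiability over the domain `D`. -/
def Satisfiable {K D X : Type*} [AddCommGroup D] [LinearOrder D] (ι : K → D)
    (φ : Fml K X) : Prop :=
  ∃ α : X → D, Sat ι α φ

/-! ### Constraints -/

/-- The comparison operators allowed in constraints. -/
inductive Cmp
  | eq | ne | lt | le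

/-- A literal `e₁ ⊙ e₂` with `⊙` one of `=`, `≠`, `<`, `≤`. -/
structure Lit (K X : Type*) where
  cmp : Cmp
  lhs : Expr K X
  rhs : Expr K X

/-- Constraints: literals closed under conjunction. -/
inductive Constraint (K X : Type*)
  | lit (l : Lit K X) : Constraint K X
  | and (c d : Constraint K X) : Constraint K X

namespace Lit

variable {K X Y : Type*}

/-- The variable `x` occurs in the literal. -/
def Occurs (x : X) (l : Lit K X) : Prop :=
  letI := Classical.decEq X
  x ∈ l.lhs.varFinset ∨ x ∈ l.rhs.varFinset

/-- Renaming of the variables of a literal. -/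
def rename (f : X → Y) (l : Lit K X) : Lit K Y :=
  ⟨l.cmp, l.lhs.relabel f, l.rhs.relabel f⟩

/-- The equality literal `x = y` between two variables. -/
def varEq (x y : X) : Lit K X := ⟨Cmp.eq, Language.Term.var x, Language.Term.var y⟩

/-- The literal `x = k` between a variable and a constant. -/
def varEqConst (x : X) (k : K) : Lit K X :=
  ⟨Cmp.eq, Language.Term.var x, Language.Term.func (LinFun.const k : LinFun K 0) Fin.elim0⟩

/-- The literal as a first-order formula. -/
def toFml (l : Lit K X) : Fml K X :=
  match l.cmp with
  | Cmp.eq => l.lhs.equal l.rhs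
  | Cmp.ne => (l.lhs.equal l.rhs).not
  | Cmp.lt => Language.Relations.formula₂ (L := linLang K) LinRel.lt l.lhs l.rhs
  | Cmp.le => Language.Relations.formula₂ (L := linLang K) LinRel.le l.lhs l.rhs

end Lit

namespace Constraint

variable {K X : Type*}

/-- The literals of which the constraint is the conjunction. -/
def lits : Constraint K X → Set (Lit K X)
  | lit l => {l}
  | and c d => c.lits ∪ d.lits

/-- The constraint as a first-order formula. -/
def toFml : Constraint K X → Fml K X
  | lit l => l.toFml
  | and c d => c.toFml ⊓ d.toFml

end Constraint

/-- The conjunction `⋀ C` of a finite set of constraints. -/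
noncomputable def conj {K X : Type*} (C : Finset (Constraint K X)) : Fml K X :=
  Language.Formula.iInf fun c : {c // c ∈ C} => c.1.toFml

/-! ### Data-aware dynamic systems with arithmetic -/

/-- A DDSA with control states `B`, actions `A` and data variables `V`. In guards, the variable
`Sum.inl v` is the read variable `vʳ` and `Sum.inr v` is the write variable `vʷ`. The transition
function may be partial: `trans b a = none` means that `a` is not available in `b`. -/
structure DDSA (K B A V : Type*) where
  init : B
  trans : B → A → Option B
  final : Set B
  initVal : V → K
  guard : A → Constraint K (V ⊕ V)

namespace DDSA

variable {K B A V : Type*} (S : DDSA K B A V)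

/-- `write(a)`: the variables whose write version occurs in the guard of `a`. -/
def write (a : A) : Set V :=
  {v | ∃ l ∈ (S.guard a).lits, l.Occurs (Sum.inr v)}

/-- The transition formula `Δ_a = guard(a) ∧ ⋀_{v ∉ write(a)} vʷ = vʳ`. -/
noncomputable def transFml [Finite V] (a : A) : Fml K (V ⊕ V) :=
  (S.guard a).toFml ⊓
    Language.Formula.iInf fun v : {v : V // v ∉ S.write a} =>
      (Lit.varEq (K := K) (Sum.inr v.1 : V ⊕ V) (Sum.inl v.1)).toFml

/-- The literals of the transition formula `Δ_a`. -/
def transLits (a : A) : Set (Lit K (V ⊕ V)) :=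
  (S.guard a).lits ∪ {l | ∃ v : V, v ∉ S.write a ∧ l = Lit.varEq (Sum.inr v) (Sum.inl v)}

/-- `update(φ, a) = ∃ U. φ(U) ∧ Δ_a(U, V)`. -/
noncomputable def update [Finite V] (φ : Fml K V) (a : A) : Fml K V :=
  Language.Formula.iExs V
    (Language.Formula.relabel (Sum.inr : V → V ⊕ V) φ ⊓
      Language.Formula.relabel (Sum.swap : V ⊕ V → V ⊕ V) (S.transFml a))

/-- The initial constraints `⋀_v v = α₀(v)`. -/
noncomputable def initFml [Finite V] : Fml K V :=
  Language.Formula.iInf fun v : V => (Lit.varEqConst v (S.initVal v)).toFml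

/-- A symbolic run `b₀ →a₁ b₁ →a₂ ⋯ →aₙ bₙ`; `act k` is the action from `state k` to
`state (k + 1)`. -/
structure SymRun where
  len : ℕ
  state : Fin (len + 1) → B
  act : Fin len → A
  start : state 0 = S.init
  step : ∀ k : Fin len, S.trans (state k.castSucc) (act k) = some (state k.succ)

/-- The history constraint of a sequence of `n` actions and of a sequence `C₀, …, Cₙ` of
sets of verification constraints. -/
noncomputable def histAux [Finite V] : (n : ℕ) → (Fin n → A) →
    (Fin (n + 1) → Finset (Constraint K V)) → Fml K V
  | 0, _, C => S.initFml ⊓ conj (C 0)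
  | n + 1, act, C =>
      S.update (histAux n (Fin.init act) (Fin.init C)) (act (Fin.last n)) ⊓ conj (C (Fin.last _))

variable {S}

/-- The final state of a symbolic run. -/
def SymRun.last (σ : S.SymRun) : B := σ.state (Fin.last σ.len)

/-- Verification constraint sequences `⟨C₀, …, Cₙ⟩` with `Cᵢ ⊆ 𝒞` along `σ`. -/
def SymRun.CSeq (σ : S.SymRun) (𝒞 : Finset (Constraint K V)) :=
  {C : Fin (σ.len + 1) → Finset (Constraint K V) // ∀ k, C k ⊆ 𝒞}

/-- The history constraint `h(σ, C)`. -/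
noncomputable def SymRun.hist [Finite V] (σ : S.SymRun) {𝒞 : Finset (Constraint K V)}
    (C : σ.CSeq 𝒞) : Fml K V :=
  S.histAux σ.len σ.act C.1

/-! ### Computation graphs and bounded lookback -/

/-- The instances `vᵢ` of the variables, `0 ≤ i ≤ n`. -/
abbrev SymRun.Node (σ : S.SymRun) := V × Fin (σ.len + 1)

/-- The literals of `Δ_{a_k}(V_{k-1}, V_k)` for `1 ≤ k ≤ n` and of `C_k(V_k)` for
`0 ≤ k ≤ n`. -/
def SymRun.lits (σ : S.SymRun) {𝒞 : Finset (Constraint K V)} (C : σ.CSeq 𝒞) :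
    Set (Lit K σ.Node) :=
  {l | ∃ k : Fin σ.len, ∃ m ∈ S.transLits (σ.act k),
      l = m.rename (Sum.elim (fun v => (v, k.castSucc)) (fun v => (v, k.succ)))} ∪
  {l | ∃ k : Fin (σ.len + 1), ∃ c ∈ C.1 k, ∃ m ∈ c.lits, l = m.rename (fun v => (v, k))}

/-- The computation graph: two instances are adjacent iff they occur in a common literal. -/
def SymRun.compGraph (σ : S.SymRun) {𝒞 : Finset (Constraint K V)} (C : σ.CSeq 𝒞) :
    SimpleGraph σ.Node :=
  SimpleGraph.fromRel fun p q => ∃ l ∈ σ.lits C, l.Occurs p ∧ l.Occurs q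

/-- The subgraph of the edges given by equality literals `x_i = y_j` between two instances. -/
def SymRun.eqGraph (σ : S.SymRun) {𝒞 : Finset (Constraint K V)} (C : σ.CSeq 𝒞) :
    SimpleGraph σ.Node :=
  SimpleGraph.fromRel fun p q => Lit.varEq p q ∈ σ.lits C

/-- The graph obtained from the computation graph by collapsing all edges that stem from
equality literals: its vertices are the connected components of `eqGraph`. -/
def SymRun.collapsed (σ : S.SymRun) {𝒞 : Finset (Constraint K V)} (C : σ.CSeq 𝒞) :
    SimpleGraph (σ.eqGraph C).ConnectedComponent :=
  SimpleGraph.fromRel fun c d => ∃ p q : σ.Node, (σ.eqGraph C).connectedComponentMk p = c ∧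
    (σ.eqGraph C).connectedComponentMk q = d ∧ (σ.compGraph C).Adj p q

variable (S)

/-- `K₀`-bounded lookback: for every symbolic run and every verification constraint sequence,
all acyclic paths in the collapsed computation graph have length at most `K₀`. -/
def HasBoundedLookback (𝒞 : Finset (Constraint K V)) (K₀ : ℕ) : Prop :=
  ∀ (σ : S.SymRun) (C : σ.CSeq 𝒞) (c d : (σ.eqGraph C).ConnectedComponent)
    (p : (σ.collapsed C).Walk c d), p.IsPath → p.length ≤ K₀

/-! ### History sets and finite summaries -/

/-- `Φ` is a history set: every history constraint has an equivalent representative in `Φ`, and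
`Φ` consists of such representatives only. -/
def IsHistorySet [Finite V] {D : Type*} [AddCommGroup D] [LinearOrder D] (ι : K → D)
    (𝒞 : Finset (Constraint K V)) (Φ : Set (B × Fml K V)) : Prop :=
  (∀ (σ : S.SymRun) (C : σ.CSeq 𝒞), ∃ φ, (σ.last, φ) ∈ Φ ∧ Equivalent ι (σ.hist C) φ) ∧
  ∀ p ∈ Φ, ∃ (σ : S.SymRun) (C : σ.CSeq 𝒞), σ.last = p.1 ∧ Equivalent ι (σ.hist C) p.2

end DDSA

/-- Numbering of the function symbols, from a numbering of the constants. -/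
instance {K : Type*} [Encodable K] : Encodable (Σ i, (linLang K).Functions i) :=
  Encodable.ofLeftInjection (α := K ⊕ Bool)
    (fun f => match f with
      | ⟨_, LinFun.const k⟩ => Sum.inl k
      | ⟨_, LinFun.add⟩ => Sum.inr true
      | ⟨_, LinFun.sub⟩ => Sum.inr false)
    (fun s => match s with
      | Sum.inl k => some ⟨0, LinFun.const k⟩
      | Sum.inr true => some ⟨2, LinFun.add⟩
      | Sum.inr false => some ⟨2, LinFun.sub⟩)
    (by rintro ⟨_, _ | _ | _⟩ <;> rfl)

/-- Numbering of the relation symbols. -/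
instance {K : Type*} : Encodable (Σ i, (linLang K).Relations i) :=
  Encodable.ofLeftInjection (α := Bool)
    (fun r => match r with
      | ⟨_, LinRel.lt⟩ => true
      | ⟨_, LinRel.le⟩ => false)
    (fun s => match s with
      | true => some ⟨2, LinRel.lt⟩
      | false => some ⟨2, LinRel.le⟩)
    (by rintro ⟨_, _ | _⟩ <;> rfl)

/-- The Gödel number of a formula: the number of the word that spells it. -/
def Fml.code {K V : Type*} [Encodable K] [Encodable V] (φ : Fml K V) : ℕ :=
  Encodable.encode (Language.BoundedFormula.listEncode φ)

/-- The relation `r` is decidable on the set `F` of formulas: an algorithm decides, given the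
Gödel numbers of two formulas of `F`, whether they are related. -/
def DecidableOn {K V : Type*} [Encodable K] [Encodable V] (F : Set (Fml K V))
    (r : Fml K V → Fml K V → Prop) : Prop :=
  ∃ P : ℕ × ℕ → Prop, ComputablePred P ∧
    ∀ φ ∈ F, ∀ ψ ∈ F, (P (Fml.code φ, Fml.code ψ) ↔ r φ ψ)

namespace DDSA

variable {K B A V : Type*} (S : DDSA K B A V)

/-- `(Φ, r)` is a summary. In the last field, `φ'` and `ψ'` are representatives in `Φ` of
`update(φ, a) ∧ C` and `update(ψ, a) ∧ C`. -/
structure IsSummary [Finite V] [Encodable K] [Encodable V]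
    {D : Type*} [AddCommGroup D] [LinearOrder D] (ι : K → D)
    (𝒞 : Finset (Constraint K V)) (Φ : Set (B × Fml K V)) (r : Setoid (Fml K V)) : Prop where
  historySet : S.IsHistorySet ι 𝒞 Φ
  contains : ∀ φ ∈ Prod.snd '' Φ, ∀ ψ ∈ Prod.snd '' Φ, Equivalent ι φ ψ → r φ ψ
  decidable : DecidableOn (Prod.snd '' Φ) r
  equisat : ∀ b φ ψ, (b, φ) ∈ Φ → (b, ψ) ∈ Φ → r φ ψ → (Satisfiable ι φ ↔ Satisfiable ι ψ)
  step : ∀ b φ ψ, (b, φ) ∈ Φ → (b, ψ) ∈ Φ → r φ ψ →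
    ∀ a b', S.trans b a = some b' → ∀ C ⊆ 𝒞, ∀ φ' ψ', (b', φ') ∈ Φ → (b', ψ') ∈ Φ →
      Equivalent ι (S.update φ a ⊓ conj C) φ' → Equivalent ι (S.update ψ a ⊓ conj C) ψ' →
      r φ' ψ'

/-- `(S, 𝒞)` has finite summary: there is a summary whose equivalence relation has finitely many
classes on the history set. -/
def HasFiniteSummary [Finite V] [Encodable K] [Encodable V]
    {D : Type*} [AddCommGroup D] [LinearOrder D] (ι : K → D)
    (𝒞 : Finset (Constraint K V)) : Prop :=
  ∃ (Φ : Set (B × Fml K V)) (r : Setoid (Fml K V)),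
    S.IsSummary ι 𝒞 Φ r ∧ (Quotient.mk r '' (Prod.snd '' Φ)).Finite

end DDSA

end DDSAFormal

/-! A history constraint says that a system of literals on the nodes `v_i` has a solution with
prescribed values at the last instant. Whatever the run, these literals are instances of finitely
many templates. A solution is constant on classes of nodes joined by equality literals, so the
system lives on the collapsed graph, where every path has length at most `K₀`.

Short paths allow shallow quantifiers. In each connected component one root is quantified; once it
is removed, the rest splits into independent components, each containing a neighbour of the root,
and paths from that neighbour are shorter by one (`exists_mem_definableSets`). Hence quantifier
depth `K₀ + 1` suffices. For finitely many relations and a fixed depth only finitely many sets are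
definable (`finite_definableSets`), because repeated conjuncts count once.

So there are finitely many history constraints up to `≡` (`finite_models_hist`). One representative
per state and model set gives a finite history set, and `≡` itself is the summary relation. Literals
act as opaque relations throughout, and decidability is that of a finite table. -/

namespace DDSAFormal

/-! ### Sets definable by nested existential quantifiers over finitely many relations -/

section Definable

universe u

variable {D I : Type*} {ar : I → Type*} (R : ∀ i, Set (ar i → D))

/-- The sets of assignments of `X` defined by one of the relations `R` applied to elements
of `X`. -/
def atomicSets (X : Type*) : Set (Set (X → D)) :=
  Set.range fun t : Σ i, ar i → X => {α | α ∘ t.2 ∈ R t.1}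

/-- Existential quantification over the additional variable `none`. -/
def projNone {X : Type*} (s : Set (Option X → D)) : Set (X → D) :=
  {α | ∃ d : D, (fun o : Option X => o.elim d α) ∈ s}

/-- The sets of assignments of `X` defined from the relations `R` by conjunction and
existential quantification, with quantifiers nested to depth `k`. -/
def definableSets : ℕ → (X : Type u) → Set (Set (X → D))
  -- Conjunctions are intersections of arbitrary subfamilies, so duplicates vanish and finiteness
  -- needs no normal form; the empty subfamily gives the whole space.
  | 0, X => Set.sInter '' 𝒫 (atomicSets R X)
  | k + 1, X => Set.sInter '' 𝒫 (atomicSets R X ∪ projNone '' definableSets k (Option X))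

theorem finite_atomicSets [Finite I] [∀ i, Finite (ar i)] (X : Type*) [Finite X] :
    (atomicSets R X).Finite :=
  Set.finite_range _

/-- Each depth takes subfamilies of a finite family: the atoms, plus projections of the finitely
many sets of the previous depth in one more variable. -/
theorem finite_definableSets [Finite I] [∀ i, Finite (ar i)] (k : ℕ) :
    ∀ (X : Type u) [Finite X], (definableSets R k X).Finite := by
  induction k with
  | zero => exact fun X _ => (finite_atomicSets R X).powerset.image _
  | succ k ih =>
    exact fun X _ => ((finite_atomicSets R X).union ((ih (Option X)).image _)).powerset.image _

/-! ### Eliminating the vertices of a graph with short paths -/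

variable {Q : Type*} (G : SimpleGraph Q)

/-- Reachability along edges with both ends in `U`. -/
def ReachIn (U : Set Q) : Q → Q → Prop :=
  Relation.ReflTransGen fun a b => G.Adj a b ∧ a ∈ U ∧ b ∈ U

variable {G}

theorem ReachIn.symm {U : Set Q} {a b : Q} (h : ReachIn G U a b) : ReachIn G U b a :=
  haveI : Std.Symm fun a b => G.Adj a b ∧ a ∈ U ∧ b ∈ U :=
    ⟨fun _ _ h => ⟨h.1.symm, h.2.2, h.2.1⟩⟩
  (Relation.ReflTransGen.stdSymm (r := fun a b => G.Adj a b ∧ a ∈ U ∧ b ∈ U)).symm _ _ h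

theorem ReachIn.mem {U : Set Q} {a b : Q} (h : ReachIn G U a b) (ha : a ∈ U) : b ∈ U := by
  induction h with
  | refl => exact ha
  | tail _ h _ => exact h.2.2

theorem ReachIn.of_adj {U : Set Q} {a b : Q} (h : G.Adj a b) (ha : a ∈ U) (hb : b ∈ U) :
    ReachIn G U a b :=
  Relation.ReflTransGen.single ⟨h, ha, hb⟩

/-- Roots chosen in each connected component of `U` can be chosen uniformly. -/
theorem exists_uniform_root {U : Set Q} {P : Q → Prop}
    (h : ∀ u ∈ U, ∃ r, ReachIn G U u r ∧ P r) :
    ∃ root : Q → Q, (∀ u ∈ U, ReachIn G U u (root u) ∧ P (root u)) ∧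
      ∀ u v, ReachIn G U u v → root u = root v := by
  classical
  let s : Setoid Q := ⟨ReachIn G U, fun _ => Relation.ReflTransGen.refl, fun h => h.symm,
    fun h h' => Relation.ReflTransGen.trans h h'⟩
  choose! g hg using h
  -- The root is chosen at the canonical representative, so it depends on the component only.
  refine ⟨fun u => g (Quotient.mk s u).out, fun u hu => ?_, fun u v huv => ?_⟩
  · have h1 : ReachIn G U u (Quotient.mk s u).out := (Quotient.mk_out (s := s) u).symm
    have h2 := hg _ (h1.mem hu)
    exact ⟨h1.trans h2.1, h2.2⟩
  · have : Quotient.mk s u = Quotient.mk s v := Quotient.sound huv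
    simp only [this]

/-- A vertex of the component of `r` other than `r` is connected to a neighbour of `r` inside
the component with `r` removed. -/
theorem ReachIn.exists_adj {U : Set Q} {a r : Q} (h : ReachIn G U a r) (hne : a ≠ r) :
    ∃ b, G.Adj r b ∧ b ∈ {x | ReachIn G U x r} \ {r} ∧
      ReachIn G ({x | ReachIn G U x r} \ {r}) a b := by
  -- Walking from `a` towards `r`, the vertex just before the first visit to `r` is the required
  -- neighbour.
  induction h using Relation.ReflTransGen.head_induction_on with
  | refl => exact absurd rfl hne
  | @head a c hac hcr ih =>
    have ha : a ∈ {x | ReachIn G U x r} \ {r} := ⟨Relation.ReflTransGen.head hac hcr, hne⟩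
    by_cases hc : c = r
    · subst hc
      exact ⟨a, hac.1.symm, ha, Relation.ReflTransGen.refl⟩
    · obtain ⟨b, hrb, hb, hcb⟩ := ih hc
      exact ⟨b, hrb, hb, Relation.ReflTransGen.head ⟨hac.1, ha, hcr, hc⟩ hcb⟩

/-- If the paths inside `U` are shorter than `k`, then solvability over `U` of a system of
instances of the relations `R` is definable, in terms of the values on the boundary, with
quantifier depth `k`. -/
theorem exists_mem_definableSets (L : Set (Σ i, ar i → Q))
    (hL : ∀ t ∈ L, ∀ y y', t.2 y = t.2 y' ∨ G.Adj (t.2 y) (t.2 y')) (k : ℕ) :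
    ∀ (X : Type u) (p : X → Q) (U : Set Q), (∀ x, p x ∉ U) →
      (∀ a ∈ U, ∀ b, G.Adj a b → b ∈ U ∨ b ∈ Set.range p) →
      (∀ u ∈ U, ∃ r, ReachIn G U u r ∧ ∀ w (q : G.Walk r w), q.IsPath →
        (∀ x ∈ q.support, x ∈ U) → q.length < k) →
      ∃ s ∈ definableSets R k X, ∀ β : Q → D, β ∘ p ∈ s ↔
        ∃ β' : Q → D, Set.EqOn β' β Uᶜ ∧
          ∀ t ∈ L, Set.range t.2 ⊆ U ∪ Set.range p → β' ∘ t.2 ∈ R t.1 := by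
  classical
  induction k with
  | zero =>
    intro X p U hd hb hroot
    -- The trivial path already has length `0`, which is not below the bound `0`.
    have hU : U = ∅ := by
      refine Set.eq_empty_of_forall_notMem fun u hu => ?_
      obtain ⟨r, hr, hq⟩ := hroot u hu
      exact absurd (hq r .nil .nil (by simpa using hr.mem hu)) (by simp)
    subst hU
    -- The conjunction of the literals lying on the boundary. Since `p` need not be injective, every
    -- lift `g` is admitted.
    refine ⟨_, ⟨{s | ∃ t ∈ L, ∃ g : ar t.1 → X, p ∘ g = t.2 ∧ s = {α | α ∘ g ∈ R t.1}},
      ?_, rfl⟩, fun β => ?_⟩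
    · rintro _ ⟨t, -, g, -, rfl⟩
      exact ⟨⟨t.1, g⟩, rfl⟩
    · constructor
      · intro h
        refine ⟨β, fun _ _ => rfl, fun t ht hr => ?_⟩
        have : ∀ y, ∃ x, p x = t.2 y := fun y => by
          simpa using hr (Set.mem_range_self y)
        choose g hg using this
        have hg' : p ∘ g = t.2 := funext hg
        have := h _ ⟨t, ht, g, hg', rfl⟩
        rw [← hg']
        exact this
      · rintro ⟨β', hβ, h⟩ _ ⟨t, ht, g, hg, rfl⟩
        have hβ : β' = β := funext fun x => hβ (by simp)
        subst hβ
        have := h t ht (by rw [← hg]; exact (Set.range_comp_subset_range g p).trans (by simp))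
        rw [← hg] at this
        exact this
  | succ k ih =>
    intro X p U hd hb hroot
    obtain ⟨root, hr, hr'⟩ := exists_uniform_root hroot
    set C : Q → Set Q := fun u => {x | ReachIn G U x (root u)}
    have hrU : ∀ u ∈ U, root u ∈ U := fun u hu => (hr u hu).1.mem hu
    have hCU : ∀ u ∈ U, C u ⊆ U := fun u hu x hx => ReachIn.mem (ReachIn.symm hx) (hrU u hu)
    have hCr : ∀ u, root u ∈ C u := fun u => Relation.ReflTransGen.refl
    -- The root joins the boundary as the variable `none`, and the induction hypothesis treats its
    -- component without it.
    have key : ∀ u ∈ U, ∃ s ∈ definableSets R k (Option X), ∀ β : Q → D,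
        β ∘ (fun o : Option X => o.elim (root u) p) ∈ s ↔
        ∃ β' : Q → D, Set.EqOn β' β (C u \ {root u})ᶜ ∧
          ∀ t ∈ L, Set.range t.2 ⊆ C u ∪ Set.range p → β' ∘ t.2 ∈ R t.1 := by
      intro u hu
      have hrange : C u \ {root u} ∪ Set.range (fun o : Option X => o.elim (root u) p) =
          C u ∪ Set.range p := by
        ext x
        simp only [Set.mem_union, Set.mem_sdiff, Set.mem_singleton_iff, Set.mem_range,
          Option.exists, Option.elim]
        constructor
        · rintro (h | rfl | h)
          exacts [.inl h.1, .inl (hCr u), .inr h]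
        · rintro (h | h)
          · by_cases hx : x = root u
            exacts [.inr (.inl hx.symm), .inl ⟨h, hx⟩]
          · exact .inr (.inr h)
      have := ih (Option X) (fun o => o.elim (root u) p) (C u \ {root u}) ?_ ?_ ?_
      · rwa [hrange] at this
      · rintro (_ | x)
        · simp
        · exact fun h => hd x (hCU u hu h.1)
      · rintro a ⟨ha, hne⟩ b hab
        have haU := hCU u hu ha
        rw [← Set.mem_union, hrange]
        rcases hb a haU b hab with h | h
        · exact .inl ((ReachIn.of_adj hab haU h).symm.trans ha)
        · exact .inr h
      · rintro a ⟨ha, hne⟩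
        obtain ⟨b, hrb, hbm, hreach⟩ := ReachIn.exists_adj ha hne
        refine ⟨b, hreach, fun w q hq hs => ?_⟩
        -- Prefixing the old root lengthens the path by one, so the bound drops from `k + 1` to `k`.
        have hlen := (hr u hu).2 w (.cons hrb q)
          (hq.cons fun h => (hs _ h).2 rfl) (by
            intro x hx
            rcases List.mem_cons.1 (by simpa using hx) with rfl | hx
            · exact hrU u hu
            · exact hCU u hu (hs x hx).1)
        simpa using hlen
    choose! s hs hsβ using key
    have hupd : ∀ u ∈ U, ∀ (β : Q → D) (d : D),
        (fun o : Option X => o.elim d (β ∘ p)) =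
          Function.update β (root u) d ∘ (fun o : Option X => o.elim (root u) p) := by
      intro u hu β d
      funext o
      rcases o with _ | x
      · simp
      · have : p x ≠ root u := fun h => hd x (h ▸ hrU u hu)
        simp [this]
    -- Boundary literals, together with one existential statement for each component.
    refine ⟨_, ⟨{s | ∃ t ∈ L, ∃ g : ar t.1 → X, p ∘ g = t.2 ∧ s = {α | α ∘ g ∈ R t.1}} ∪
      (fun u => projNone (s u)) '' U, ?_, rfl⟩, fun β => ?_⟩
    · rintro _ (⟨t, -, g, -, rfl⟩ | ⟨u, hu, rfl⟩)
      · exact .inl ⟨⟨t.1, g⟩, rfl⟩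
      · exact .inr ⟨_, hs u hu, rfl⟩
    · constructor
      · intro h
        have hex : ∀ u ∈ U, ∃ β' : Q → D, Set.EqOn β' β (C u)ᶜ ∧
            ∀ t ∈ L, Set.range t.2 ⊆ C u ∪ Set.range p → β' ∘ t.2 ∈ R t.1 := by
          intro u hu
          obtain ⟨d, hdm⟩ := h _ (.inr ⟨u, hu, rfl⟩)
          rw [hupd u hu, hsβ u hu] at hdm
          obtain ⟨β', h1, h2⟩ := hdm
          refine ⟨β', fun x hx => ?_, h2⟩
          have hne : x ≠ root u := fun h => hx (h ▸ hCr u)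
          rw [h1 (fun h => hx h.1), Function.update_of_ne hne]
        have : Nonempty (Q → D) := ⟨β⟩
        choose! e he heL using hex
        -- Gluing: indexing by `root x` instead of `x` makes all vertices of a component use the
        -- same solution.
        refine ⟨fun x => if x ∈ U then e (root x) x else β x,
          fun x hx => if_neg hx, fun t ht hrg => ?_⟩
        -- The entries of a literal are pairwise equal or adjacent, so it meets at most one
        -- component of `U`.
        by_cases htU : ∃ y, t.2 y ∈ U
        · obtain ⟨y, hy⟩ := htU
          have hreach : ∀ y', t.2 y' ∈ U → ReachIn G U (t.2 y) (t.2 y') := fun y' hy' => by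
            rcases hL t ht y y' with h | h
            · rw [h]; exact Relation.ReflTransGen.refl
            · exact .of_adj h hy hy'
          have hy1 := hrU _ hy
          have hrr : root (root (t.2 y)) = root (t.2 y) := (hr' _ _ (hr _ hy).1).symm
          have hsub : Set.range t.2 ⊆ C (root (t.2 y)) ∪ Set.range p := by
            rintro _ ⟨y', rfl⟩
            rcases hrg (Set.mem_range_self y') with h | h
            · refine .inl ?_
              show ReachIn G U (t.2 y') (root (root (t.2 y)))
              rw [hrr]
              exact (hreach y' h).symm.trans (hr _ hy).1
            · exact .inr h
          have := heL _ hy1 t ht hsub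
          convert this using 1
          funext y'
          simp only [Function.comp_apply]
          split_ifs with hU
          · rw [hr' _ _ (hreach y' hU)]
          · exact (he _ hy1 fun h => hU (hCU _ hy1 h)).symm
        · push Not at htU
          have : ∀ y, ∃ x, p x = t.2 y := fun y =>
            (hrg (Set.mem_range_self y)).resolve_left (htU y)
          choose g hg using this
          have hg' : p ∘ g = t.2 := funext hg
          have : (β ∘ p) ∘ g ∈ R t.1 := h _ (.inl ⟨t, ht, g, hg', rfl⟩)
          convert this using 1
          funext y
          simp [htU y, hg y]
      · rintro ⟨β', hβ, h⟩ _ (⟨t, ht, g, hg, rfl⟩ | ⟨u, hu, rfl⟩)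
        · have := h t ht (by
            rw [← hg]
            exact (Set.range_comp_subset_range g p).trans Set.subset_union_right)
          rw [← hg] at this
          have heq : β ∘ p = β' ∘ p := funext fun x => (hβ (hd x)).symm
          rw [heq]
          exact this
        · refine ⟨β' (root u), ?_⟩
          rw [hupd u hu, hsβ u hu]
          -- The global solution is kept on the component only; the quantified value is the one it
          -- takes at the root.
          refine ⟨fun x => if x ∈ C u then β' x else β x, fun x hx => ?_, fun t ht hrg => ?_⟩
          · by_cases hxr : x = root u
            · subst hxr
              simp [hCr u]
            · have : x ∉ C u := fun h => hx ⟨h, hxr⟩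
              simp [this, hxr]
          · have := h t ht (hrg.trans (Set.union_subset_union_left _ (hCU u hu)))
            convert this using 1
            funext y
            simp only [Function.comp_apply]
            split_ifs with hy
            · rfl
            · obtain ⟨x, hx⟩ := (hrg (Set.mem_range_self y)).resolve_left hy
              rw [← hx]
              exact (hβ (hd x)).symm

end Definable

end DDSAFormal

namespace DDSAFormal

/-! ### Truth of formulas, literals and constraints -/

section Semantics

variable {K D X Y : Type*} [AddCommGroup D] [LinearOrder D] (ι : K → D)

theorem sat_inf (α : X → D) (φ ψ : Fml K X) :
    Sat ι α (φ ⊓ ψ) ↔ Sat ι α φ ∧ Sat ι α ψ :=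
  letI := linStructure ι
  Language.Formula.realize_inf

theorem sat_iInf {J : Type*} [Finite J] (α : X → D) (φ : J → Fml K X) :
    Sat ι α (Language.Formula.iInf φ) ↔ ∀ j, Sat ι α (φ j) :=
  letI := linStructure ι
  Language.Formula.realize_iInf

theorem sat_iExs [Finite Y] (α : X → D) (φ : Fml K (X ⊕ Y)) :
    Sat ι α (Language.Formula.iExs Y φ) ↔ ∃ β : Y → D, Sat ι (Sum.elim α β) φ :=
  letI := linStructure ι
  Language.Formula.realize_iExs

theorem sat_relabel (α : Y → D) (f : X → Y) (φ : Fml K X) :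
    Sat ι α (Language.Formula.relabel f φ) ↔ Sat ι (α ∘ f) φ :=
  letI := linStructure ι
  Language.Formula.realize_relabel

/-- The value of an expression. -/
def Expr.val (α : X → D) (e : Expr K X) : D :=
  letI := linStructure ι
  e.realize α

theorem Expr.val_relabel (α : Y → D) (f : X → Y) (e : Expr K X) :
    Expr.val ι α (e.relabel f) = Expr.val ι (α ∘ f) e :=
  letI := linStructure ι
  Language.Term.realize_relabel

theorem Expr.val_congr [DecidableEq X] {α α' : X → D} {e : Expr K X}
    (h : ∀ x ∈ e.varFinset, α x = α' x) : Expr.val ι α e = Expr.val ι α' e := by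
  let := linStructure ι
  exact (Language.Term.realize_restrictVar (f := Subtype.val) (v := α) α fun _ => rfl).symm.trans
    (Language.Term.realize_restrictVar (f := Subtype.val) (v := α) α' fun a => h _ a.2)

/-- The meaning of a comparison operator. -/
def Cmp.Rel : Cmp → D → D → Prop
  | .eq, a, b => a = b
  | .ne, a, b => a ≠ b
  | .lt, a, b => a < b
  | .le, a, b => a ≤ b

theorem Lit.sat_toFml (α : X → D) (l : Lit K X) :
    Sat ι α l.toFml ↔ l.cmp.Rel (Expr.val ι α l.lhs) (Expr.val ι α l.rhs) := by
  let := linStructure ι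
  obtain ⟨c, e, e'⟩ := l
  cases c
  · exact Language.Formula.realize_equal
  · exact Language.Formula.realize_not.trans (not_congr Language.Formula.realize_equal)
  · exact Language.Formula.realize_rel₂
  · exact Language.Formula.realize_rel₂

theorem Lit.sat_rename (α : Y → D) (f : X → Y) (l : Lit K X) :
    Sat ι α (l.rename f).toFml ↔ Sat ι (α ∘ f) l.toFml := by
  rw [Lit.sat_toFml, Lit.sat_toFml]
  simp only [Lit.rename, Expr.val_relabel]

theorem Lit.sat_congr {α α' : X → D} {l : Lit K X} (h : ∀ x, l.Occurs x → α x = α' x) :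
    Sat ι α l.toFml ↔ Sat ι α' l.toFml := by
  classical
  have hl : ∀ x ∈ l.lhs.varFinset, α x = α' x := fun x hx => h x (by
    unfold Lit.Occurs; left; convert hx)
  have hr : ∀ x ∈ l.rhs.varFinset, α x = α' x := fun x hx => h x (by
    unfold Lit.Occurs; right; convert hx)
  rw [Lit.sat_toFml, Lit.sat_toFml, Expr.val_congr ι hl, Expr.val_congr ι hr]

theorem Lit.sat_varEq (α : X → D) (x y : X) :
    Sat ι α (Lit.varEq (K := K) x y).toFml ↔ α x = α y :=
  Lit.sat_toFml ι α _

theorem Lit.sat_varEqConst (α : X → D) (x : X) (k : K) :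
    Sat ι α (Lit.varEqConst x k).toFml ↔ α x = ι k :=
  Lit.sat_toFml ι α _

theorem Expr.mem_varFinset_relabel [DecidableEq X] [DecidableEq Y] (f : X → Y) {x : X} :
    ∀ {e : Expr K X}, x ∈ e.varFinset → f x ∈ (e.relabel f).varFinset
  | .var y, h => by
    simp only [Language.Term.varFinset, Finset.mem_singleton] at h
    simp [Language.Term.varFinset, h]
  | .func g ts, h => by
    simp only [Language.Term.varFinset, Finset.mem_biUnion, Finset.mem_univ, true_and] at h
    obtain ⟨i, hi⟩ := h
    simp only [Language.Term.relabel, Language.Term.varFinset, Finset.mem_biUnion,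
      Finset.mem_univ, true_and]
    exact ⟨i, Expr.mem_varFinset_relabel f hi⟩

theorem Lit.Occurs.rename (f : X → Y) {x : X} {l : Lit K X} (h : l.Occurs x) :
    (l.rename f).Occurs (f x) := by
  classical
  exact h.imp (Expr.mem_varFinset_relabel f) (Expr.mem_varFinset_relabel f)

/-- Initial literals mention a single node, so adding them to the system creates no edges. -/
theorem Lit.occurs_varEqConst {x y : X} {k : K} (h : (Lit.varEqConst x k).Occurs y) :
    y = x := by
  rcases h with h | h
  · simpa [Lit.varEqConst, Language.Term.varFinset] using h
  · simp [Lit.varEqConst, Language.Term.varFinset] at h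

theorem Constraint.finite_lits : ∀ c : Constraint K X, c.lits.Finite
  | .lit _ => Set.finite_singleton _
  | .and c d => c.finite_lits.union d.finite_lits

theorem Constraint.sat_toFml (α : X → D) :
    ∀ c : Constraint K X, Sat ι α c.toFml ↔ ∀ l ∈ c.lits, Sat ι α l.toFml
  | .lit l => by simp [Constraint.toFml, Constraint.lits]
  | .and c d => by
    simp only [Constraint.toFml, Constraint.lits, sat_inf, c.sat_toFml α, d.sat_toFml α,
      Set.mem_union, or_imp, forall_and]

theorem sat_conj (α : X → D) (C : Finset (Constraint K X)) :
    Sat ι α (conj C) ↔ ∀ c ∈ C, ∀ l ∈ c.lits, Sat ι α l.toFml := by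
  simp only [conj, sat_iInf, Constraint.sat_toFml, Subtype.forall]

end Semantics

/-! ### Gödel numbers and decidability of finite relations -/

theorem Fml.code_injective {K V : Type*} [Encodable K] [Encodable V] :
    Function.Injective (Fml.code : Fml K V → ℕ) := by
  intro φ ψ h
  have h1 := Encodable.encode_injective h
  have h2 := Language.BoundedFormula.encoding.encode_injective
    (a₁ := ⟨0, φ⟩) (a₂ := ⟨0, ψ⟩) h1
  simpa using h2

theorem computablePred_mem_of_finite {s : Set (ℕ × ℕ)} (hs : s.Finite) :
    ComputablePred (· ∈ s) := by
  suffices PrimrecPred (· ∈ s) from this.computablePred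
  induction s, hs using Set.Finite.induction_on with
  | empty => exact (PrimrecRel.comp Primrec.eq (Primrec.const 0) (Primrec.const 1)).of_eq (by simp)
  | @insert a s _ _ ih =>
    exact ((PrimrecRel.comp Primrec.eq .id (Primrec.const a)).or ih).of_eq (by simp)

/-- Every relation on a finite set of formulas is decidable on it. -/
theorem decidableOn_of_finite {K V : Type*} [Encodable K] [Encodable V] {F : Set (Fml K V)}
    (hF : F.Finite) (r : Fml K V → Fml K V → Prop) : DecidableOn F r := by
  -- The decision procedure is the finite table of codes of related pairs; it is correct because
  -- codes are injective.
  refine ⟨_, computablePred_mem_of_finite (s := (fun p : Fml K V × Fml K V =>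
    (Fml.code p.1, Fml.code p.2)) '' {p ∈ F ×ˢ F | r p.1 p.2})
    (((hF.prod hF).subset (Set.sep_subset _ _)).image _), fun φ hφ ψ hψ => ⟨?_, fun h => ?_⟩⟩
  · rintro ⟨⟨φ', ψ'⟩, ⟨-, h⟩, heq⟩
    simp only [Prod.mk.injEq] at heq
    rwa [← Fml.code_injective heq.1, ← Fml.code_injective heq.2]
  · exact ⟨(φ, ψ), ⟨⟨hφ, hψ⟩, h⟩, rfl⟩

namespace DDSA

variable {K B A V D : Type*} [AddCommGroup D] [LinearOrder D] (ι : K → D) (S : DDSA K B A V)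

/-! ### History constraints as systems of literals -/

section History

variable [Finite V]

theorem sat_initFml (α : V → D) : Sat ι α S.initFml ↔ ∀ v, α v = ι (S.initVal v) := by
  simp only [initFml, sat_iInf, Lit.sat_varEqConst]

theorem sat_transFml (α : V ⊕ V → D) (a : A) :
    Sat ι α (S.transFml a) ↔ ∀ l ∈ S.transLits a, Sat ι α l.toFml := by
  simp only [transFml, sat_inf, sat_iInf, Constraint.sat_toFml, transLits, Set.mem_union, or_imp,
    forall_and, Set.mem_ofPred_eq, Subtype.forall]
  refine and_congr_right fun _ => ⟨?_, fun h v hv => h _ ⟨v, hv, rfl⟩⟩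
  rintro h _ ⟨v, hv, rfl⟩
  exact h v hv

theorem sat_update (α : V → D) (φ : Fml K V) (a : A) :
    Sat ι α (S.update φ a) ↔ ∃ β : V → D, Sat ι β φ ∧ Sat ι (Sum.elim β α) (S.transFml a) := by
  simp only [update, sat_iExs, sat_inf, sat_relabel, Sum.elim_comp_inr, Sum.elim_swap]

/-- The variables bound by successive updates are the earlier copies of `V`, so the nested
existentials amount to one valuation per instant. -/
theorem sat_histAux : ∀ (n : ℕ) (act : Fin n → A) (C : Fin (n + 1) → Finset (Constraint K V))
    (α : V → D), Sat ι α (S.histAux n act C) ↔ ∃ β : Fin (n + 1) → V → D,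
      (∀ v, β 0 v = ι (S.initVal v)) ∧
      (∀ k : Fin n, Sat ι (Sum.elim (β k.castSucc) (β k.succ)) (S.transFml (act k))) ∧
      (∀ k, Sat ι (β k) (conj (C k))) ∧ β (Fin.last n) = α
  | 0, act, C, α => by
    rw [histAux, sat_inf, sat_initFml]
    constructor
    · rintro ⟨h1, h2⟩
      exact ⟨fun _ => α, h1, fun k => k.elim0, fun k => by rwa [Fin.fin_one_eq_zero k], rfl⟩
    · rintro ⟨β, h1, -, h3, rfl⟩
      exact ⟨h1, h3 0⟩
  | n + 1, act, C, α => by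
    rw [histAux, sat_inf, sat_update]
    constructor
    · rintro ⟨⟨γ, h, ht⟩, hC⟩
      obtain ⟨β, h1, h2, h3, rfl⟩ := (sat_histAux n _ _ γ).1 h
      refine ⟨Fin.snoc (α := fun _ => V → D) β α, ?_, ?_, ?_, by simp⟩
      · rw [← Fin.castSucc_zero, Fin.snoc_castSucc]
        exact h1
      · intro k
        refine Fin.lastCases ?_ (fun k => ?_) k
        · rw [Fin.snoc_castSucc, Fin.succ_last, Fin.snoc_last]
          exact ht
        · rw [Fin.snoc_castSucc, Fin.succ_castSucc, Fin.snoc_castSucc]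
          exact h2 k
      · intro k
        refine Fin.lastCases ?_ (fun k => ?_) k
        · rw [Fin.snoc_last]
          exact hC
        · rw [Fin.snoc_castSucc]
          exact h3 k
    · rintro ⟨β, h1, h2, h3, rfl⟩
      refine ⟨⟨β (Fin.last n).castSucc, (sat_histAux n _ _ _).2
        ⟨fun k => β k.castSucc, h1, fun k => h2 k.castSucc, fun k => h3 k.castSucc, rfl⟩,
        h2 (Fin.last n)⟩, h3 _⟩

end History

/-! ### Literal templates and the system on the collapsed graph -/

/-- The literals over `Vʳ` and `Vʷ` of which all literals of history constraints are instances. -/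
def templates (𝒞 : Finset (Constraint K V)) : Set (Lit K (V ⊕ V)) :=
  (⋃ a, S.transLits a) ∪ (⋃ c ∈ 𝒞, Lit.rename Sum.inr '' c.lits) ∪
    Set.range fun v => Lit.varEqConst (Sum.inr v) (S.initVal v)

theorem finite_templates [Finite A] [Finite V] (𝒞 : Finset (Constraint K V)) :
    (S.templates 𝒞).Finite := by
  refine ((Set.finite_iUnion fun a => ?_).union ?_).union (Set.finite_range _)
  · refine (S.guard a).finite_lits.union
      ((Set.finite_range fun v : V => Lit.varEq (Sum.inr v : V ⊕ V) (Sum.inl v)).subset ?_)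
    rintro _ ⟨v, -, rfl⟩
    exact ⟨v, rfl⟩
  · exact 𝒞.finite_toSet.biUnion fun c _ => c.finite_lits.image _

/-- The relation expressed by a literal on the values of the variables that occur in it. -/
def litRel {Y : Type*} (m : Lit K Y) : Set ({y // m.Occurs y} → D) :=
  {a | ∃ e : Y → D, (∀ y, e y.1 = a y) ∧ Sat ι e m.toFml}

/-- The arity is cut down to the occurring variables because only these are adjacent in the graph;
the others do not affect truth. -/
theorem comp_mem_litRel {Y N : Type*} (m : Lit K Y) (f : Y → N) (β : N → D) :
    β ∘ f ∘ Subtype.val ∈ litRel ι m ↔ Sat ι β (m.rename f).toFml := by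
  rw [Lit.sat_rename]
  constructor
  · rintro ⟨e, he, h⟩
    exact (Lit.sat_congr ι fun y hy => he ⟨y, hy⟩).1 h
  · exact fun h => ⟨β ∘ f, fun _ => rfl, h⟩

variable {S} {𝒞 : Finset (Constraint K V)}

namespace SymRun

/-- The literals of a history constraint, including the initial assignment. -/
def histLits (σ : S.SymRun) (C : σ.CSeq 𝒞) : Set (Lit K σ.Node) :=
  σ.lits C ∪ Set.range fun v => Lit.varEqConst (v, 0) (S.initVal v)

theorem sat_hist [Finite V] (σ : S.SymRun) (C : σ.CSeq 𝒞) (α : V → D) :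
    Sat ι α (σ.hist C) ↔ ∃ β : σ.Node → D, (∀ l ∈ σ.histLits C, Sat ι β l.toFml) ∧
      ∀ v, β (v, Fin.last _) = α v := by
  rw [hist, sat_histAux]
  simp only [sat_transFml, sat_conj]
  constructor
  · rintro ⟨β, h1, h2, h3, rfl⟩
    refine ⟨fun p => β p.2 p.1, ?_, fun _ => rfl⟩
    rintro _ ((⟨k, m, hm, rfl⟩ | ⟨k, c, hc, m, hm, rfl⟩) | ⟨v, rfl⟩)
    · rw [Lit.sat_rename]
      convert h2 k m hm using 1
      funext x
      rcases x with x | x <;> rfl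
    · rw [Lit.sat_rename]
      exact h3 k c hc m hm
    · exact (Lit.sat_varEqConst ι _ _ _).2 (h1 v)
  · rintro ⟨β, h, hα⟩
    refine ⟨fun k v => β (v, k), fun v => ?_, fun k m hm => ?_, fun k c hc m hm => ?_,
      funext hα⟩
    · exact (Lit.sat_varEqConst ι _ _ _).1 (h _ (.inr ⟨v, rfl⟩))
    · have := h _ (.inl (.inl ⟨k, m, hm, rfl⟩))
      rw [Lit.sat_rename] at this
      convert this using 1
      funext x
      rcases x with x | x <;> rfl
    · have := h _ (.inl (.inr ⟨k, c, hc, m, hm, rfl⟩))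
      rwa [Lit.sat_rename] at this

theorem exists_template (σ : S.SymRun) (C : σ.CSeq 𝒞) {l : Lit K σ.Node}
    (hl : l ∈ σ.histLits C) : ∃ m ∈ S.templates 𝒞, ∃ f : V ⊕ V → σ.Node, m.rename f = l := by
  have hcomp : ∀ (m : Lit K V) (f : V → σ.Node),
      (m.rename (Sum.inr : V → V ⊕ V)).rename (Sum.elim f f) = m.rename f := fun m f => by
    simp [Lit.rename, Language.Term.relabel_relabel]
  rcases hl with (⟨k, m, hm, rfl⟩ | ⟨k, c, hc, m, hm, rfl⟩) | ⟨v, rfl⟩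
  · exact ⟨m, .inl (.inl (Set.mem_iUnion.2 ⟨_, hm⟩)), _, rfl⟩
  · exact ⟨_, .inl (.inr (Set.mem_biUnion (C.2 k hc) ⟨m, hm, rfl⟩)), _, hcomp m _⟩
  -- An initial literal is placed by sending both copies of `V` to instant `0`.
  · refine ⟨_, .inr ⟨v, rfl⟩, fun x => (x.elim id id, 0), ?_⟩
    simp only [Lit.varEqConst, Lit.rename, Language.Term.relabel, Sum.elim_inr, id]
    congr
    exact funext fun i => i.elim0

/-- This is the hypothesis `hL` of `exists_mem_definableSets`: a shared literal gives an edge, which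
survives unless its ends are merged. -/
theorem eq_or_adj_of_occurs (σ : S.SymRun) (C : σ.CSeq 𝒞) {l : Lit K σ.Node}
    (hl : l ∈ σ.histLits C) {p q : σ.Node} (hp : l.Occurs p) (hq : l.Occurs q) :
    (σ.eqGraph C).connectedComponentMk p = (σ.eqGraph C).connectedComponentMk q ∨
      (σ.collapsed C).Adj ((σ.eqGraph C).connectedComponentMk p)
        ((σ.eqGraph C).connectedComponentMk q) := by
  by_cases hne : (σ.eqGraph C).connectedComponentMk p = (σ.eqGraph C).connectedComponentMk q
  · exact .inl hne
  · rcases hl with hl | ⟨v, rfl⟩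
    · refine .inr ((SimpleGraph.fromRel_adj _ _ _).2 ⟨hne, .inl ⟨p, q, rfl, rfl, ?_⟩⟩)
      exact (SimpleGraph.fromRel_adj _ _ _).2
        ⟨fun h => hne (by rw [h]), .inl ⟨l, hl, hp, hq⟩⟩
    · rw [Lit.occurs_varEqConst hp, Lit.occurs_varEqConst hq]
      exact .inl rfl

theorem eq_of_connectedComponentMk_eq (σ : S.SymRun) (C : σ.CSeq 𝒞) {β : σ.Node → D}
    (hβ : ∀ l ∈ σ.histLits C, Sat ι β l.toFml) {p q : σ.Node}
    (h : (σ.eqGraph C).connectedComponentMk p = (σ.eqGraph C).connectedComponentMk q) :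
    β p = β q := by
  obtain ⟨w⟩ := SimpleGraph.ConnectedComponent.eq.1 h
  induction w with
  | nil => rfl
  | cons hadj w ih =>
    refine Eq.trans ?_ (ih (SimpleGraph.ConnectedComponent.eq.2 ⟨w⟩))
    rcases ((SimpleGraph.fromRel_adj _ _ _).1 hadj).2 with h | h
    · exact (Lit.sat_varEq ι _ _ _).1 (hβ _ (.inl h))
    · exact ((Lit.sat_varEq ι _ _ _).1 (hβ _ (.inl h))).symm

/-- The instances of the templates in the collapsed computation graph. -/
def collapsedLits (σ : S.SymRun) (C : σ.CSeq 𝒞) :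
    Set (Σ m : S.templates 𝒞, {y // m.1.Occurs y} → (σ.eqGraph C).ConnectedComponent) :=
  {t | ∃ (m : S.templates 𝒞) (f : V ⊕ V → σ.Node), m.1.rename f ∈ σ.histLits C ∧
    t = ⟨m, (σ.eqGraph C).connectedComponentMk ∘ f ∘ Subtype.val⟩}

/-- Solutions respect the equality literals, hence factor through the collapse; conversely, a
solution on components pulls back to nodes. -/
theorem sat_hist_iff_collapsed [Finite V] (σ : S.SymRun) (C : σ.CSeq 𝒞) (α : V → D) :
    Sat ι α (σ.hist C) ↔ ∃ γ : (σ.eqGraph C).ConnectedComponent → D,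
      (∀ t ∈ σ.collapsedLits C, γ ∘ t.2 ∈ litRel ι t.1.1) ∧
      ∀ v, γ ((σ.eqGraph C).connectedComponentMk (v, Fin.last _)) = α v := by
  rw [sat_hist]
  constructor
  · rintro ⟨β, h, hα⟩
    have hmk : ∀ p, β ((σ.eqGraph C).connectedComponentMk p).out = β p := fun p =>
      σ.eq_of_connectedComponentMk_eq ι C h (Quot.out_eq _)
    refine ⟨fun c => β c.out, ?_, fun v => (hmk _).trans (hα v)⟩
    rintro _ ⟨m, f, hm, rfl⟩
    have := (comp_mem_litRel ι m.1 f β).2 (h _ hm)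
    convert this using 1
    exact funext fun y => hmk _
  · rintro ⟨γ, h, hα⟩
    refine ⟨γ ∘ (σ.eqGraph C).connectedComponentMk, fun l hl => ?_, hα⟩
    obtain ⟨m, hm, f, rfl⟩ := σ.exists_template C hl
    exact (comp_mem_litRel ι m f _).1 (h _ ⟨⟨m, hm⟩, f, hl, rfl⟩)

/-- Under `K₀`-bounded lookback, the models of a history constraint are given by equalities
between variables and a set of bounded quantifier depth. -/
theorem exists_definableSets_hist [Finite V] {K₀ : ℕ} (hS : S.HasBoundedLookback 𝒞 K₀)
    (σ : S.SymRun) (C : σ.CSeq 𝒞) :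
    ∃ (E : Set (V × V)),
      ∃ s ∈ definableSets (fun m : S.templates 𝒞 => litRel ι m.1) (K₀ + 1) V,
      {α | Sat ι α (σ.hist C)} = {α | (∀ e ∈ E, α e.1 = α e.2) ∧ α ∈ s} := by
  set mk := (σ.eqGraph C).connectedComponentMk
  set p : V → (σ.eqGraph C).ConnectedComponent := fun v => mk (v, Fin.last _)
  obtain ⟨s, hs, hsβ⟩ := exists_mem_definableSets (G := σ.collapsed C)
    (fun m : S.templates 𝒞 => litRel ι m.1) (σ.collapsedLits C) (by
      rintro _ ⟨m, f, hm, rfl⟩ y y'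
      exact σ.eq_or_adj_of_occurs C hm (y.2.rename f) (y'.2.rename f)) (K₀ + 1) V p
    -- The boundary consists of the components of last-instant nodes and `U` is everything else.
    -- Each vertex of `U` serves as its own root, since all paths have length below `K₀ + 1`.
    (Set.range p)ᶜ (fun x h => h (Set.mem_range_self x))
    (fun _ _ b _ => (em (b ∈ Set.range p)).symm)
    (fun u _ => ⟨u, Relation.ReflTransGen.refl, fun w q hq _ => Nat.lt_succ_of_le (hS σ C _ _ q hq)⟩)
  -- `E` records which last-instant variables are merged; it is what lets `α` factor through `p`.
  -- The value `0` off the range of `p` is harmless, as those vertices are quantified.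
  refine ⟨{e | p e.1 = p e.2}, s, hs, Set.ext fun α => ?_⟩
  simp only [Set.mem_ofPred_eq, sat_hist_iff_collapsed]
  constructor
  · rintro ⟨γ, h, hα⟩
    refine ⟨fun e he => ?_, ?_⟩
    · rw [← hα, ← hα]
      exact congrArg γ he
    · have : α = γ ∘ p := funext fun v => (hα v).symm
      rw [this, hsβ]
      exact ⟨γ, fun _ _ => rfl, fun t ht _ => h t ht⟩
  · rintro ⟨hE, hα⟩
    have hfac : Function.FactorsThrough α p := fun v w h => hE (v, w) h
    have h0 : Function.extend p α 0 ∘ p = α := funext fun v => hfac.extend_apply _ v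
    rw [← h0, hsβ] at hα
    obtain ⟨γ, h1, h2⟩ := hα
    refine ⟨γ, fun t ht => h2 t ht (by simp), fun v => ?_⟩
    rw [← h0]
    exact h1 (not_not_intro (Set.mem_range_self v))

end SymRun

/-! ### From finitely many model sets to a finite summary -/

/-- Under bounded lookback there are finitely many history constraints up to equivalence. -/
theorem finite_models_hist [Finite A] [Finite V] {K₀ : ℕ} (hS : S.HasBoundedLookback 𝒞 K₀) :
    {M : Set (V → D) | ∃ (σ : S.SymRun) (C : σ.CSeq 𝒞), M = {α | Sat ι α (σ.hist C)}}.Finite := by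
  have := (S.finite_templates 𝒞).to_subtype
  -- Both `E` and `s` range over finite sets independent of the run.
  refine (Set.Finite.image2 (fun (E : Set (V × V)) (s : Set (V → D)) =>
    {α | (∀ e ∈ E, α e.1 = α e.2) ∧ α ∈ s}) Set.finite_univ (finite_definableSets
      (fun m : S.templates 𝒞 => litRel ι m.1) (K₀ + 1) V)).subset ?_
  rintro _ ⟨σ, C, rfl⟩
  obtain ⟨E, s, hs, h⟩ := σ.exists_definableSets_hist ι hS C
  exact ⟨E, trivial, s, hs, h.symm⟩

variable (𝒞) in
/-- If there are finitely many history constraints up to equivalence, then some history set is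
finite. -/
theorem exists_finite_historySet [Finite B] [Finite V]
    (h : {M : Set (V → D) | ∃ (σ : S.SymRun) (C : σ.CSeq 𝒞),
      M = {α | Sat ι α (σ.hist C)}}.Finite) :
    ∃ Φ : Set (B × Fml K V), Φ.Finite ∧ S.IsHistorySet ι 𝒞 Φ := by
  let H : Set (B × Fml K V) := {p | ∃ (σ : S.SymRun) (C : σ.CSeq 𝒞), p = (σ.last, σ.hist C)}
  let g : B × Fml K V → B × Set (V → D) := fun p => (p.1, {α | Sat ι α p.2})
  have hfin : (g '' H).Finite := by
    refine (Set.finite_univ.prod h).subset ?_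
    rintro _ ⟨_, ⟨σ, C, rfl⟩, rfl⟩
    exact ⟨trivial, σ, C, rfl⟩
  -- One history constraint is kept for each pair of a final state and a set of models.
  obtain ⟨Φ, hΦ, hbij⟩ := Set.SurjOn.exists_bijOn_subset (Set.surjOn_image g H)
  refine ⟨Φ, (hbij.finite_iff_finite).2 hfin, fun σ C => ?_, fun p hp => ?_⟩
  · obtain ⟨⟨b, φ⟩, hm, heq⟩ := hbij.surjOn ⟨_, ⟨σ, C, rfl⟩, rfl⟩
    simp only [g, Prod.mk.injEq] at heq
    obtain ⟨rfl, heq⟩ := heq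
    exact ⟨φ, hm, fun α => (Set.ext_iff.1 heq α).symm⟩
  · obtain ⟨σ, C, rfl⟩ := hΦ hp
    exact ⟨σ, C, rfl, fun _ => Iff.rfl⟩

/-- Logical equivalence as a setoid on formulas. -/
def equivalentSetoid : Setoid (Fml K V) where
  r := Equivalent ι
  iseqv := ⟨fun _ _ => Iff.rfl, fun h α => (h α).symm, fun h h' α => (h α).trans (h' α)⟩

theorem equivalent_step [Finite V] {φ ψ : Fml K V} (h : Equivalent ι φ ψ) (a : A)
    (C : Finset (Constraint K V)) :
    Equivalent ι (S.update φ a ⊓ conj C) (S.update ψ a ⊓ conj C) := fun α => by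
  simp only [sat_inf, sat_update, h _]

/-- On a finite history set, logical equivalence is a finite summary. -/
theorem hasFiniteSummary_of_finite [Finite V] [Encodable K] [Encodable V]
    {Φ : Set (B × Fml K V)} (hfin : Φ.Finite) (hΦ : S.IsHistorySet ι 𝒞 Φ) :
    S.HasFiniteSummary ι 𝒞 := by
  refine ⟨Φ, equivalentSetoid ι, ⟨hΦ, fun φ _ ψ _ h => h,
    decidableOn_of_finite (hfin.image _) _, fun b φ ψ _ _ h => exists_congr h, ?_⟩,
    (hfin.image _).image _⟩
  intro b φ ψ _ _ h a b' _ C _ φ' ψ' _ _ hφ hψ α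
  exact (hφ α).symm.trans ((equivalent_step (S := S) ι h a C α).trans (hψ α))

end DDSA

end DDSAFormal

theorem mainTheorem2 {D : Type*} [AddCommGroup D] [LinearOrder D] [IsOrderedAddMonoid D]
    {K : Type*} [Encodable K] (ι : K → D)
    {B A V : Type*} [Finite B] [Finite A] [Finite V] [Encodable V]
    (S : DDSAFormal.DDSA K B A V) (𝒞 : Finset (DDSAFormal.Constraint K V))
    (K₀ : ℕ) (h : S.HasBoundedLookback 𝒞 K₀) :
    S.HasFiniteSummary ι 𝒞 := by
  obtain ⟨Φ, hfin, hΦ⟩ :=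
    DDSAFormal.DDSA.exists_finite_historySet ι 𝒞 (DDSAFormal.DDSA.finite_models_hist ι h)
  exact DDSAFormal.DDSA.hasFiniteSummary_of_finite ι hfin hΦ
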